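/- Let $A$ be a binary $n\times m$ matrix with $n$ even, and let $G$ be the complete graph on its rows. For distinct rows $r_i,r_j$ let $w(i,j)$ be the number of columns in which both have a $1$; each such column gives one bandpass between $r_i$ and $r_j$. A $b$-matching is a subgraph in which every degree is at most $b$, a matching is a $1$-matching, and a $2$-matching is acyclic if it contains no cycle. Let $M_1$ be a perfect matching of $G$ that is a maximum weight matching for $w$. Let $A'$ be obtained from $A$ by changing to $0$ every $1$ that lies in a bandpass of $M_1$ (i.e. both entries of any column that has a $1$ in both rows of an edge of $M_1$), and let $w'$ be the edge weights on $G$ obtained from $A'$ in the same way as $w$ from $A$; for a subgraph $H$, $w'(H)$ is the sum of the $w'$-weights of its edges. Let $\mathcal C$ be a maximum weight $4$-matching for $w'$, decomposed into two edge-disjoint $2$-matchings $\mathcal C_1,\mathcal C_2$. Let $\pi^*$ be a row permutation from which the maximum number of bandpasses can be extracted (a bandpass of a permutation is a pair of vertically consecutive $1$'s in a column, and extracted bandpasses share no entry). Let $S_2(\pi^*)$ be the set of maximal segments of consecutive $1$'s in a column of $\pi^*$ that have length exactly $2$, each being one bandpass. Let $B_2\subseteq S_2(\pi^*)$ consist of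 the bandpasses that pair up as follows: one in rows $r_i,r_j$ and another in rows $r_k,r_\ell$ of the same column, such that $(r_j,r_k)\in M_1$ (so that their $1$'s in rows $r_j,r_k$ form a bandpass of $M_1$), while their $1$'s in rows $r_i$ and $r_\ell$ lie in no bandpass of $M_1$. Then the edge set of $\mathcal C_1\cup\mathcal C_2$ can be partitioned into (possibly empty) matchings $X_0,X_1,X_2,X_3,Y_0,Y_1,Y_2,Y_3$ such that 1. $G[M_1\cup X_i]$ and $G[M_1\cup Y_i]$ are acyclic $2$-matchings for all $i\in\{0,1,2,3\}$; 2. $X_2\cup X_3$ is a matching and $G[M_1\cup X_2\cup X_3]$ contains no cycle of length $4$; 3. $w'(X_3)\le \frac12 w'(X_2)$. Moreover, for every such partition, any matching $M_2$ of largest weight $w'$ among the seven matchings $X_0,X_1,X_2,Y_0,Y_1,Y_2,Y_3$ is such that $G[M_1\cup M_2]$ is an acyclic $2$-matching, $$w'(M_2)\ \ge\ \frac1{7.5}\,w'(\mathcal C)\qquad\text{and}\qquad w'(M_2)\ \ge\ \frac1{15}\,|B_2|.$$ -/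

import Mathlib

namespace Bandpass

section Graphs

variable {V : Type*}

/-- A spanning subgraph of the complete graph on `V`, given by its edges, in which every vertex
has degree at most `b`. -/
def IsBMatching (b : ℕ) (H : SimpleGraph V) : Prop :=
  ∀ v : V, (H.neighborSet v).Finite ∧ (H.neighborSet v).ncard ≤ b

/-- A matching is a `1`-matching. -/
def IsMatching (H : SimpleGraph V) : Prop := IsBMatching 1 H

/-- A matching that covers every vertex. -/
def IsPerfectMatching (H : SimpleGraph V) : Prop :=
  IsMatching H ∧ ∀ v : V, ∃ u : V, H.Adj v u

/-- A `2`-matching without cycles. -/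
def IsAcyclicTwoMatching (H : SimpleGraph V) : Prop :=
  IsBMatching 2 H ∧ H.IsAcyclic

/-- `H` contains no cycle of length `4`. -/
def HasNoFourCycle (H : SimpleGraph V) : Prop :=
  ∀ (v : V) (p : H.Walk v v), p.IsCycle → p.length ≠ 4

open Classical in
/-- The sum of the weights of the edges of `H`. -/
noncomputable def weight [Fintype V] (w : Sym2 V → ℕ) (H : SimpleGraph V) : ℕ :=
  ∑ e : Sym2 V with e ∈ H.edgeSet, w e

/-- A `b`-matching of largest weight in the complete graph on `V` with edge weights `w`. -/
def IsMaxWeightBMatching [Fintype V] (w : Sym2 V → ℕ) (b : ℕ) (H : SimpleGraph V) : Prop :=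
  IsBMatching b H ∧ ∀ H' : SimpleGraph V, IsBMatching b H' → weight w H' ≤ weight w H

end Graphs

section Matrices

variable {n m : ℕ}

open Classical in
/-- The static weight of an edge: the number of bandpasses that its two rows form when they are
adjacent, which is the number of columns in which both have a `1`. -/
noncomputable def edgeWeight (A : Matrix (Fin n) (Fin m) Bool) (e : Sym2 (Fin n)) : ℕ :=
  (Finset.univ.filter fun c : Fin m => ∀ r ∈ e, A r c = true).card

/-- The `1` of row `r` in column `c` belongs to a bandpass of the matching `M`. -/
def InBandpassOf (A : Matrix (Fin n) (Fin m) Bool) (M : SimpleGraph (Fin n))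
    (r : Fin n) (c : Fin m) : Prop :=
  A r c = true ∧ ∃ s : Fin n, M.Adj r s ∧ A s c = true

open Classical in
/-- The matrix in which every `1` of a bandpass of `M` has been changed to `0`. -/
noncomputable def residual (A : Matrix (Fin n) (Fin m) Bool) (M : SimpleGraph (Fin n)) :
    Matrix (Fin n) (Fin m) Bool :=
  fun r c => A r c && !decide (InBandpassOf A M r c)

/-- After the rows have been permuted by `π` (row `π p` is put in position `p`), position `p` of
column `c` holds a `1`. Positions outside the matrix hold none. -/
def OneAt (A : Matrix (Fin n) (Fin m) Bool) (π : Equiv.Perm (Fin n)) (p : ℕ) (c : Fin m) : Prop :=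
  ∃ h : p < n, A (π ⟨p, h⟩) c = true

/-- A set of bandpasses of the permuted matrix, no two of which share an entry. The pair `(p, c)`
is the bandpass in column `c` at positions `p` and `p + 1`. -/
def IsBandpassPacking (A : Matrix (Fin n) (Fin m) Bool) (π : Equiv.Perm (Fin n))
    (S : Finset (Fin n × Fin m)) : Prop :=
  (∀ x ∈ S, OneAt A π x.1 x.2 ∧ OneAt A π ((x.1 : ℕ) + 1) x.2) ∧
  ∀ x ∈ S, ∀ y ∈ S, x.2 = y.2 → (x.1 : ℕ) + 1 ≠ (y.1 : ℕ)

open Classical in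
/-- The number of bandpasses that can be extracted from the permutation `π`. -/
noncomputable def bandpassCount (A : Matrix (Fin n) (Fin m) Bool) (π : Equiv.Perm (Fin n)) : ℕ :=
  (Finset.univ.filter fun S : Finset (Fin n × Fin m) => IsBandpassPacking A π S).sup Finset.card

/-- `π` maximizes the number of bandpasses over all row permutations. -/
def IsOptimalPermutation (A : Matrix (Fin n) (Fin m) Bool) (π : Equiv.Perm (Fin n)) : Prop :=
  ∀ σ : Equiv.Perm (Fin n), bandpassCount A σ ≤ bandpassCount A π

/-- A maximal segment of exactly `l` consecutive `1`s in column `x.2` of the permuted matrix,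
starting at position `x.1`. -/
def IsStrip (A : Matrix (Fin n) (Fin m) Bool) (π : Equiv.Perm (Fin n)) (l : ℕ)
    (x : Fin n × Fin m) : Prop :=
  (∀ i < l, OneAt A π ((x.1 : ℕ) + i) x.2) ∧ ¬ OneAt A π ((x.1 : ℕ) + l) x.2 ∧
  ∀ q : ℕ, q + 1 = (x.1 : ℕ) → ¬ OneAt A π q x.2

/-- The rows of the matrix that are met by a strip of length `l`. -/
def stripRows (π : Equiv.Perm (Fin n)) (l : ℕ) (x : Fin n × Fin m) : Finset (Fin n) :=
  Finset.univ.filter fun r => (x.1 : ℕ) ≤ π.symm r ∧ (π.symm r : ℕ) < (x.1 : ℕ) + l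

/-- The bandpasses `s` of `S₂(π)` (each length-`2` strip is one bandpass), in rows `i, j`, that are
paired up with another one, `t`, in the same column and in rows `k, l`, such that the `1`s in rows
`j` and `k` form a bandpass of `M`, while the `1`s in rows `i` and `l` belong to no bandpass
of `M`. -/
def IsB2 (A : Matrix (Fin n) (Fin m) Bool) (π : Equiv.Perm (Fin n)) (M : SimpleGraph (Fin n))
    (s : Fin n × Fin m) : Prop :=
  IsStrip A π 2 s ∧ ∃ t : Fin n × Fin m, IsStrip A π 2 t ∧ t ≠ s ∧ t.2 = s.2 ∧
    ∃ i j k l : Fin n, stripRows π 2 s = {i, j} ∧ stripRows π 2 t = {k, l} ∧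
      M.Adj j k ∧ ¬ InBandpassOf A M i s.2 ∧ ¬ InBandpassOf A M l s.2

open Classical in
/-- The set `B₂` of bandpasses. -/
noncomputable def B2 (A : Matrix (Fin n) (Fin m) Bool) (π : Equiv.Perm (Fin n))
    (M : SimpleGraph (Fin n)) : Finset (Fin n × Fin m) :=
  Finset.univ.filter fun s => IsB2 A π M s

end Matrices

section Partition

variable {V : Type*} [Fintype V]

/-- The partition of the edges of `C` into `X 0, …, X 3, Y 0, …, Y 3` (some possibly empty),
the matching `X 3` counting as half a matching. -/
structure IsSevenAndHalfPartition (w : Sym2 V → ℕ) (M C : SimpleGraph V)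
    (X Y : Fin 4 → SimpleGraph V) : Prop where
  pairwise_disjoint : Pairwise fun a b : Fin 4 ⊕ Fin 4 => Disjoint (Sum.elim X Y a) (Sum.elim X Y b)
  union_eq : (⨆ i, X i) ⊔ (⨆ j, Y j) = C
  matching_X : ∀ i, IsMatching (X i)
  matching_Y : ∀ j, IsMatching (Y j)
  acyclic_X : ∀ i, IsAcyclicTwoMatching (M ⊔ X i)
  acyclic_Y : ∀ j, IsAcyclicTwoMatching (M ⊔ Y j)
  matching_X2_X3 : IsMatching (X 2 ⊔ X 3)
  no_four_cycle : HasNoFourCycle (M ⊔ X 2 ⊔ X 3)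
  weight_X3_le : (weight w (X 3) : ℝ) ≤ (weight w (X 2) : ℝ) / 2

/-- `M₂` is a heaviest one among the seven matchings `X 0, X 1, X 2, Y 0, Y 1, Y 2, Y 3`. -/
def IsHeaviestOfSeven (w : Sym2 V → ℕ) (X Y : Fin 4 → SimpleGraph V) (M₂ : SimpleGraph V) : Prop :=
  M₂ ∈ ({X 0, X 1, X 2} ∪ Set.range Y : Set (SimpleGraph V)) ∧
  ∀ H ∈ ({X 0, X 1, X 2} ∪ Set.range Y : Set (SimpleGraph V)), weight w H ≤ weight w M₂

end Partition

end Bandpass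

/-!
Write `m u` for the partner of `u` in the perfect matching `M₁`. The partition exists for a purely
graph-theoretic reason: *the edges of any graph of maximum degree four can be partitioned into seven
matchings, none of which closes a cycle with `M₁`* (`exists_isAcyclicColoring`). Three of them serve
as `X 0, X 1, X 2` and four as `Y 0, …, Y 3`, while `X 3` is empty.

Suppose that all edges except one edge `uv`, the hole, have been coloured by such matchings, and that
`C` itself has no such colouring. At most three colours occur at each of `u` and `v`, so a colour is
missing at both; it is blocked because the path of `M₁` and of this colour that starts at `u` ends
at `v`. Such a path has only one other end. If an edge `ux` can give its colour to `uv`, then `ux`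
becomes the hole, and the colours that block it are different ones. All of them occur at `m u`, where
there are at most four, so that the counts are tight (`IsCounterexample.count`). This leaves two cases
(`IsCounterexample.blocked_or_tight`): the hole cannot turn around `u` at all (`IsBlockedAt`), or the
colours at `m u` are exactly those missing at `u` and the hole can turn to every edge at `u`
(`IsTightAt`). Moving the hole along alternating cycles shows that some hole is tight, and that a
tight hole is tight at both ends (`IsCounterexample.exists_tight`, `IsCounterexample.tight_symm`).

A tight hole travels along every walk. If it travels around a cycle through `p` that avoids `m p`,
then the set of colours at `p` changes and the one at `m p` does not, which contradicts tightness
(`IsCounterexample.not_closed_walk`). Such a cycle exists: the end `p` of a longest path has four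
neighbours, all on the path, and two of them lie on the same side of `m p`
(`IsCounterexample.false_of_tight`).

The first weight bound holds for every partition, since `X 3` weighs at most half as much as `X 2`.
For the second one, the outer rows `i, l` of the paired bandpasses in `B₂` are the edges of a graph
of maximum degree four (`isBMatching_linkGraph`), because the permutation gives two choices for the
neighbour `j` of `i`, the matching then determines `k`, and the permutation gives two choices for `l`.
Each pair contributes one to the residual weight of this graph, so that `|B₂|` is at most twice the
weight of `C` (`card_B2_le`).
-/

namespace Bandpass

/-! ### Alternating paths -/

section Paths

open SimpleGraph

variable {V : Type*}

theorem mem_of_reachable_of_closed {H : SimpleGraph V} {S : Set V}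
    (hS : ∀ a ∈ S, ∀ b, H.Adj a b → b ∈ S) {u x : V} (hu : u ∈ S) (h : H.Reachable u x) :
    x ∈ S := by
  obtain ⟨p⟩ := h
  induction p with
  | nil => exact hu
  | cons hab _ ih => exact ih (hS _ hu _ hab)

/-- In a graph of maximum degree two, two paths that start at the same vertex and avoid the same
neighbour `b` of it follow each other until they reach a vertex of degree one. -/
theorem end_eq_of_walk {H : SimpleGraph V}
    (h2 : ∀ z a b d, H.Adj z a → H.Adj z b → H.Adj z d → a = b ∨ a = d ∨ b = d)
    {v x : V} (hv : ∀ a b, H.Adj v a → H.Adj v b → a = b)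
    (hx : ∀ a b, H.Adj x a → H.Adj x b → a = b)
    {a : V} (p : H.Walk a v) (q : H.Walk a x) (hp : p.IsPath) (hq : q.IsPath) (b : V)
    (hba : H.Adj a b) (hbp : b ∉ p.support) (hbq : b ∉ q.support) : v = x := by
  induction p generalizing b with
  | nil =>
    cases q with
    | nil => rfl
    | cons h q' =>
      exact absurd (by simp [hv _ _ hba h]) hbq
  | @cons a c v h p' ih =>
    cases q with
    | nil => exact absurd (by simp [hx _ _ hba h]) hbp
    | @cons _ d _ h' q' =>
      have hcd : c = d := by
        rcases h2 _ _ _ _ hba h h' with e | e | e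
        · exact absurd (by simp [e]) hbp
        · exact absurd (by simp [e]) hbq
        · exact e
      subst hcd
      rw [Walk.cons_isPath_iff] at hp hq
      exact ih hv q' hp.1 hq.1 _ h.symm hp.2 hq.2

/-- In a graph of maximum degree two, a component has at most two vertices of degree at most one. -/
theorem end_unique {H : SimpleGraph V}
    (h2 : ∀ z a b d, H.Adj z a → H.Adj z b → H.Adj z d → a = b ∨ a = d ∨ b = d)
    {u v x : V} (hu : ∀ a b, H.Adj u a → H.Adj u b → a = b)
    (hv : ∀ a b, H.Adj v a → H.Adj v b → a = b)
    (hx : ∀ a b, H.Adj x a → H.Adj x b → a = b)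
    (huv : u ≠ v) (hux : u ≠ x) (h : H.Reachable u v) (h' : H.Reachable u x) : v = x := by
  obtain ⟨p, hp⟩ := h.exists_isPath
  obtain ⟨q, hq⟩ := h'.exists_isPath
  cases p with
  | nil => exact absurd rfl huv
  | @cons _ c _ h p' =>
    cases q with
    | nil => exact absurd rfl hux
    | @cons _ d _ h' q' =>
      obtain rfl := hu _ _ h h'
      rw [Walk.cons_isPath_iff] at hp hq
      exact end_eq_of_walk h2 hv hx p' q' hp.1 hq.1 u h.symm hp.2 hq.2

/-- The alternating path that starts at `u` with an edge of `M` and continues with edges of `G`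
and `M` in turn ends at `v`: edges of `G` at `u` itself are ignored. -/
def Leads (M G : SimpleGraph V) (u v : V) : Prop :=
  (M ⊔ G.deleteIncidenceSet u).Reachable u v

variable {M G : SimpleGraph V} {m : V → V}

theorem deleteIncidenceSet_eq_self {u : V} (h : ∀ y, ¬ G.Adj u y) :
    G.deleteIncidenceSet u = G := by
  ext a b
  rw [deleteIncidenceSet_adj]
  refine ⟨fun h => h.1, fun hab => ⟨hab, ?_, ?_⟩⟩
  · rintro rfl; exact h _ hab
  · rintro rfl; exact h _ hab.symm

theorem leads_iff_of_free {u v : V} (h : ∀ y, ¬ G.Adj u y) :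
    Leads M G u v ↔ (M ⊔ G).Reachable u v := by
  rw [Leads, deleteIncidenceSet_eq_self h]

theorem Leads.reachable {u v : V} (h : Leads M G u v) : (M ⊔ G).Reachable u v :=
  h.mono (sup_le_sup le_rfl (deleteIncidenceSet_le _ _))

theorem partner_partner (hm : ∀ u x, M.Adj u x ↔ x = m u) (u : V) : m (m u) = u :=
  ((hm _ _).1 ((hm u (m u)).2 rfl).symm).symm

theorem partner_ne (hm : ∀ u x, M.Adj u x ↔ x = m u) (u : V) : m u ≠ u :=
  ((hm u (m u)).2 rfl).ne'

theorem Leads.unique (hm : ∀ u x, M.Adj u x ↔ x = m u)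
    (hG : ∀ a b b', G.Adj a b → G.Adj a b' → b = b') {u x y : V}
    (hx : ∀ b, ¬ G.Adj x b) (hy : ∀ b, ¬ G.Adj y b) (hxu : x ≠ u) (hyu : y ≠ u)
    (h : Leads M G u x) (h' : Leads M G u y) : x = y := by
  refine end_unique (H := M ⊔ G.deleteIncidenceSet u) ?_ ?_ ?_ ?_ hxu.symm hyu.symm h h'
  · intro z a b d
    simp only [sup_adj, hm, deleteIncidenceSet_adj]
    have := hG z
    grind
  all_goals
    intro a b
    simp only [sup_adj, hm, deleteIncidenceSet_adj]
    grind

/-- A path that leads from `u` to another vertex than the partner of `u` leaves the partner of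
`u`, and enters the partner of its end, by an edge of `G`. -/
theorem Leads.adj_partner (hm : ∀ u x, M.Adj u x ↔ x = m u) {u x : V}
    (hx : ∀ b, ¬ G.Adj x b) (hxu : x ≠ u) (hxm : x ≠ m u) (h : Leads M G u x) :
    (∃ y, G.Adj (m u) y) ∧ ∃ y, G.Adj (m x) y := by
  constructor
  · by_contra! hc
    have := mem_of_reachable_of_closed (S := {u, m u}) (H := M ⊔ G.deleteIncidenceSet u) ?_
      (by simp) h
    · rcases this with h | h
      exacts [hxu h, hxm h]
    · rintro a (rfl | rfl) b
      · simp +contextual [hm, deleteIncidenceSet_adj]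
      · simp +contextual [hm, deleteIncidenceSet_adj, partner_partner hm, hc]
  · by_contra! hc
    have := mem_of_reachable_of_closed (S := {x, m x}) (H := M ⊔ G.deleteIncidenceSet u) ?_
      (by simp) h.symm
    · rcases this with h | h
      · exact hxu h.symm
      · exact hxm (by rw [h, partner_partner hm])
    · rintro a (rfl | rfl) b
      · simp +contextual [hm, deleteIncidenceSet_adj, hx]
      · simp +contextual [hm, deleteIncidenceSet_adj, partner_partner hm, hc]

end Paths

/-! ### Acyclic colourings with a hole -/

section Colorings

open SimpleGraph

variable {V : Type*}

/-- A decomposition of the edges of `D` into seven matchings, none of which closes a cycle with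
`M`. -/
structure IsAcyclicColoring (M D : SimpleGraph V) (X : Fin 7 → SimpleGraph V) : Prop where
  adj_iff : ∀ a b, D.Adj a b ↔ ∃ c, (X c).Adj a b
  color_unique : ∀ c d a b, (X c).Adj a b → (X d).Adj a b → c = d
  matching : ∀ c a b b', (X c).Adj a b → (X c).Adj a b' → b = b'
  acyclic : ∀ c, (M ⊔ X c).IsAcyclic

/-- A colouring of `C` in which the single edge `uv`, the *hole*, has no colour. -/
structure HoleAt (M C : SimpleGraph V) (u v : V) (X : Fin 7 → SimpleGraph V) : Prop where
  adj : C.Adj u v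
  coloring : IsAcyclicColoring M (C \ edge u v) X

open Classical in
/-- The colours of the edges at `z`. -/
noncomputable def colorsAt (X : Fin 7 → SimpleGraph V) (z : V) : Finset (Fin 7) :=
  Finset.univ.filter fun c => ∃ y, (X c).Adj z y

/-- The colour classes after the edge `uv` has received the colour `c` and the edge `pq` of
colour `c` has lost it. -/
def recolor (X : Fin 7 → SimpleGraph V) (c : Fin 7) (p q u v : V) : Fin 7 → SimpleGraph V :=
  Function.update X c ((X c \ edge p q) ⊔ edge u v)

variable {M C : SimpleGraph V} {m : V → V} {X : Fin 7 → SimpleGraph V} {u v : V}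

theorem mem_colorsAt {c : Fin 7} {z : V} : c ∈ colorsAt X z ↔ ∃ y, (X c).Adj z y := by
  simp [colorsAt]

theorem notMem_colorsAt {c : Fin 7} {z : V} : c ∉ colorsAt X z ↔ ∀ y, ¬ (X c).Adj z y := by
  simp [colorsAt]

theorem HoleAt.symm (h : HoleAt M C u v X) : HoleAt M C v u X :=
  ⟨h.adj.symm, by rw [edge_comm]; exact h.coloring⟩

theorem HoleAt.ne (h : HoleAt M C u v X) : u ≠ v := h.adj.ne

theorem HoleAt.adj_iff (h : HoleAt M C u v X) (a b : V) :
    (∃ c, (X c).Adj a b) ↔ C.Adj a b ∧ s(u, v) ≠ s(a, b) := by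
  rw [← h.coloring.adj_iff, sdiff_adj, adj_edge]
  exact ⟨fun ⟨h1, h2⟩ => ⟨h1, fun e => h2 ⟨e, h1.ne⟩⟩, fun ⟨h1, h2⟩ => ⟨h1, fun e => h2 e.1⟩⟩

theorem HoleAt.adj_of_adj (h : HoleAt M C u v X) {c : Fin 7} {a b : V} (hab : (X c).Adj a b) :
    C.Adj a b ∧ s(u, v) ≠ s(a, b) := (h.adj_iff a b).1 ⟨c, hab⟩

theorem recolor_of_ne {c d : Fin 7} {p q u v : V} (h : d ≠ c) : recolor X c p q u v d = X d := by
  simp [recolor, h]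

theorem recolor_adj {c d : Fin 7} {p q u v a b : V} (huv : u ≠ v) :
    (recolor X c p q u v d).Adj a b ↔
      ((X d).Adj a b ∧ ¬ (d = c ∧ s(p, q) = s(a, b))) ∨ (d = c ∧ s(u, v) = s(a, b)) := by
  by_cases hd : d = c
  · subst hd
    simp only [recolor, Function.update_self, sup_adj, sdiff_adj, adj_edge, true_and]
    constructor
    · rintro (⟨h1, h2⟩ | ⟨h1, h2⟩)
      · exact .inl ⟨h1, fun e => h2 ⟨e, h1.ne⟩⟩
      · exact .inr h1
    · rintro (⟨h1, h2⟩ | h1)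
      · exact .inl ⟨h1, fun e => h2 e.1⟩
      · refine .inr ⟨h1, ?_⟩
        rintro rfl
        rcases Sym2.eq_iff.1 h1 with ⟨rfl, e⟩ | ⟨rfl, e⟩ <;> exact huv (by simp_all)
  · simp [recolor, hd]

/-- Moving a colour from the edge `pq` to the hole `uv` moves the hole to `pq`. -/
theorem HoleAt.move (h : HoleAt M C u v X) {c : Fin 7} {p q : V} (hpq : (X c).Adj p q)
    (hu : ∀ b, (X c).Adj u b → s(p, q) = s(u, b)) (hv : ∀ b, (X c).Adj v b → s(p, q) = s(v, b))
    (hr : ¬ (M ⊔ X c \ edge p q).Reachable u v) : HoleAt M C p q (recolor X c p q u v) := by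
  have hne := h.ne
  have hpq' := h.adj_of_adj hpq
  refine ⟨hpq'.1, ?_, ?_, ?_, ?_⟩
  · intro a b
    simp only [recolor_adj hne, sdiff_adj, adj_edge]
    constructor
    · rintro ⟨h1, h2⟩
      by_cases e : s(u, v) = s(a, b)
      · exact ⟨c, .inr ⟨rfl, e⟩⟩
      · obtain ⟨d, hd⟩ := (h.adj_iff a b).2 ⟨h1, e⟩
        exact ⟨d, .inl ⟨hd, fun e' => h2 ⟨e'.2, h1.ne⟩⟩⟩
    · rintro ⟨d, ⟨h1, h2⟩ | ⟨h1, h2⟩⟩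
      · refine ⟨(h.adj_of_adj h1).1, fun e => h2 ⟨?_, e.1⟩⟩
        refine h.coloring.color_unique _ _ _ _ h1 ?_
        rcases Sym2.eq_iff.1 e.1 with ⟨rfl, rfl⟩ | ⟨rfl, rfl⟩
        exacts [hpq, hpq.symm]
      · have hab : C.Adj a b := by
          rcases Sym2.eq_iff.1 h2 with ⟨rfl, rfl⟩ | ⟨rfl, rfl⟩
          exacts [h.adj, h.adj.symm]
        exact ⟨hab, fun e => hpq'.2 (h2.trans e.1.symm)⟩
  · intro d e a b
    simp only [recolor_adj hne]
    rintro (⟨h1, h2⟩ | ⟨h1, h2⟩) (⟨h3, h4⟩ | ⟨h3, h4⟩)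
    · exact h.coloring.color_unique _ _ _ _ h1 h3
    · exact absurd h4 (h.adj_of_adj h1).2
    · exact absurd h2 (h.adj_of_adj h3).2
    · rw [h1, h3]
  · intro d a b b'
    simp only [recolor_adj hne]
    rintro (⟨h1, h2⟩ | ⟨h1, h2⟩) (⟨h3, h4⟩ | ⟨h3, h4⟩)
    · exact h.coloring.matching _ _ _ _ h1 h3
    · subst h3
      rcases Sym2.eq_iff.1 h4 with ⟨rfl, rfl⟩ | ⟨rfl, rfl⟩
      · exact absurd ⟨rfl, hu _ h1⟩ h2
      · exact absurd ⟨rfl, hv _ h1⟩ h2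
    · subst h1
      rcases Sym2.eq_iff.1 h2 with ⟨rfl, rfl⟩ | ⟨rfl, rfl⟩
      · exact absurd ⟨rfl, hu _ h3⟩ h4
      · exact absurd ⟨rfl, hv _ h3⟩ h4
    · exact Sym2.congr_right.1 (h2.symm.trans h4)
  · intro d
    by_cases hd : d = c
    · subst hd
      have : M ⊔ recolor X d p q u v d = (M ⊔ X d \ edge p q) ⊔ edge u v := by
        simp [recolor, sup_assoc]
      rw [this]
      refine IsAcyclic.sup_edge_of_not_reachable hr ((h.coloring.acyclic d).anti ?_)
      exact sup_le_sup le_rfl sdiff_le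
    · rw [recolor_of_ne hd]
      exact h.coloring.acyclic d

/-- Without a full colouring, a colour that is missing at both ends of the hole is blocked by the
path of that colour between them. -/
theorem HoleAt.reachable_of_notMem (h : HoleAt M C u v X)
    (hno : ∀ X, ¬ IsAcyclicColoring M C X) {c : Fin 7} (hu : c ∉ colorsAt X u)
    (hv : c ∉ colorsAt X v) : (M ⊔ X c).Reachable u v ∧ ¬ M.Adj u v := by
  have key : ¬ ((M ⊔ X c) ⊔ edge u v).IsAcyclic := by
    rw [notMem_colorsAt] at hu hv
    intro hac
    have hadj : ∀ d a b, (Function.update X c (X c ⊔ edge u v) d).Adj a b ↔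
        (X d).Adj a b ∨ (d = c ∧ s(u, v) = s(a, b)) := by
      intro d a b
      by_cases hd : d = c
      · subst hd
        simp only [Function.update_self, sup_adj, adj_edge, true_and]
        refine or_congr_right ⟨fun e => e.1, fun e => ⟨e, ?_⟩⟩
        rintro rfl
        rcases Sym2.eq_iff.1 e with ⟨h1, h2⟩ | ⟨h1, h2⟩ <;> exact h.ne (by simp_all)
      · simp [hd]
    refine hno (Function.update X c (X c ⊔ edge u v)) ⟨?_, ?_, ?_, ?_⟩
    · intro a b
      simp only [hadj]
      constructor
      · intro h1
        by_cases e : s(u, v) = s(a, b)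
        · exact ⟨c, .inr ⟨rfl, e⟩⟩
        · obtain ⟨d, hd⟩ := (h.adj_iff a b).2 ⟨h1, e⟩
          exact ⟨d, .inl hd⟩
      · rintro ⟨d, h1 | ⟨-, h1⟩⟩
        · exact (h.adj_of_adj h1).1
        · rcases Sym2.eq_iff.1 h1 with ⟨rfl, rfl⟩ | ⟨rfl, rfl⟩
          exacts [h.adj, h.adj.symm]
    · intro d e a b
      simp only [hadj]
      rintro (h1 | ⟨h1, h2⟩) (h3 | ⟨h3, h4⟩)
      · exact h.coloring.color_unique _ _ _ _ h1 h3
      · exact absurd h4 (h.adj_of_adj h1).2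
      · exact absurd h2 (h.adj_of_adj h3).2
      · rw [h1, h3]
    · intro d a b b'
      simp only [hadj]
      rintro (h1 | ⟨h1, h2⟩) (h3 | ⟨h3, h4⟩)
      · exact h.coloring.matching _ _ _ _ h1 h3
      · subst h3
        rcases Sym2.eq_iff.1 h4 with ⟨rfl, rfl⟩ | ⟨rfl, rfl⟩
        · exact absurd h1 (hu _)
        · exact absurd h1 (hv _)
      · subst h1
        rcases Sym2.eq_iff.1 h2 with ⟨rfl, rfl⟩ | ⟨rfl, rfl⟩
        · exact absurd h3 (hu _)
        · exact absurd h3 (hv _)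
      · exact Sym2.congr_right.1 (h2.symm.trans h4)
    · intro d
      by_cases hd : d = c
      · subst hd
        simpa [sup_assoc] using hac
      · simpa [hd] using h.coloring.acyclic d
  constructor
  · by_contra hr
    exact key (IsAcyclic.sup_edge_of_not_reachable hr (h.coloring.acyclic c))
  · intro hM
    rw [sup_edge_of_adj _ (by simp [hM])] at key
    exact key (h.coloring.acyclic c)

theorem HoleAt.card_colorsAt_le [Finite V] (h : HoleAt M C u v X) (z : V) :
    (colorsAt X z).card ≤ (C.neighborSet z).ncard := by
  have : Nonempty V := ⟨z⟩
  have hch : ∀ c ∈ colorsAt X z, ∃ y, (X c).Adj z y := fun c hc => mem_colorsAt.1 hc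
  choose! f hf using hch
  rw [← Set.ncard_coe_finset]
  refine Set.ncard_le_ncard_of_injOn f (fun c hc => (h.adj_of_adj (hf c hc)).1) ?_
    (Set.toFinite _)
  intro c hc d hd e
  exact h.coloring.color_unique _ _ _ _ (hf c hc) (e ▸ hf d hd)

theorem HoleAt.card_colorsAt_lt [Finite V] (h : HoleAt M C u v X) :
    (colorsAt X u).card < (C.neighborSet u).ncard := by
  have : Nonempty V := ⟨u⟩
  have hch : ∀ c ∈ colorsAt X u, ∃ y, (X c).Adj u y := fun c hc => mem_colorsAt.1 hc
  choose! f hf using hch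
  have hv : v ∈ C.neighborSet u := h.adj
  rw [← Set.ncard_coe_finset, ← Set.ncard_sdiff_singleton_add_one hv (Set.toFinite _),
    Nat.lt_succ_iff]
  refine Set.ncard_le_ncard_of_injOn f (fun c hc => ⟨(h.adj_of_adj (hf c hc)).1, ?_⟩) ?_
    (Set.toFinite _)
  · intro e
    exact (h.adj_of_adj (hf c hc)).2 (by rw [show f c = v from e])
  · intro c hc d hd e
    exact h.coloring.color_unique _ _ _ _ (hf c hc) (e ▸ hf d hd)

end Colorings

/-! ### Counting colours around the hole -/

section Critical

open SimpleGraph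

variable {V : Type*}

/-- A graph `C` of maximum degree at most four without an acyclic colouring relative to the
perfect matching `M`, which matches each vertex `u` to `m u`. -/
structure IsCounterexample (M C : SimpleGraph V) (m : V → V) : Prop where
  partner : ∀ u x, M.Adj u x ↔ x = m u
  degree_le : ∀ z, (C.neighborSet z).ncard ≤ 4
  not_colorable : ∀ X, ¬ IsAcyclicColoring M C X

variable {M C : SimpleGraph V} {m : V → V} {X : Fin 7 → SimpleGraph V} {u v x : V}

/-- The effect of `recolor` on the colours at a vertex. -/
theorem HoleAt.mem_colorsAt_recolor (h : HoleAt M C u v X) {c d : Fin 7} {p q z : V}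
    (hpq : (X c).Adj p q) : d ∈ colorsAt (recolor X c p q u v) z ↔
      (d ≠ c ∧ d ∈ colorsAt X z) ∨
        (d = c ∧ (z = u ∨ z = v ∨ (c ∈ colorsAt X z ∧ z ≠ p ∧ z ≠ q))) := by
  simp only [mem_colorsAt, recolor_adj h.ne]
  by_cases hd : d = c
  · subst hd
    simp only [true_and, ne_eq, not_true_eq_false, false_and, false_or]
    constructor
    · rintro ⟨y, ⟨h1, h2⟩ | h1⟩
      · refine .inr (.inr ⟨⟨y, h1⟩, ?_, ?_⟩)
        · rintro rfl
          exact h2 (by rw [h.coloring.matching _ _ _ _ h1 hpq])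
        · rintro rfl
          exact h2 (by rw [h.coloring.matching _ _ _ _ h1 hpq.symm, Sym2.eq_swap])
      · rcases Sym2.eq_iff.1 h1 with ⟨rfl, -⟩ | ⟨-, rfl⟩ <;> simp
    · rintro (rfl | rfl | ⟨⟨y, hy⟩, hp, hq⟩)
      · exact ⟨v, .inr rfl⟩
      · exact ⟨u, .inr Sym2.eq_swap⟩
      · refine ⟨y, .inl ⟨hy, fun e => ?_⟩⟩
        rcases Sym2.eq_iff.1 e with ⟨h1, -⟩ | ⟨-, h1⟩
        exacts [hp h1.symm, hq h1.symm]
  · simp [hd]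

theorem HoleAt.ne_of_adj (h : HoleAt M C u v X) {a : Fin 7} (hx : (X a).Adj u x) : x ≠ v := by
  rintro rfl
  exact (h.adj_of_adj hx).2 rfl

theorem IsCounterexample.card_lt [Finite V] (hc : IsCounterexample M C m) (h : HoleAt M C u v X) :
    (colorsAt X u).card ≤ 3 := by
  have := h.card_colorsAt_lt
  have := hc.degree_le u
  omega

theorem IsCounterexample.card_le [Finite V] (hc : IsCounterexample M C m)
    (h : HoleAt M C u v X) (z : V) :
    (colorsAt X z).card ≤ 4 := (h.card_colorsAt_le z).trans (hc.degree_le z)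

theorem IsCounterexample.ne_partner [Finite V] (hc : IsCounterexample M C m)
    (h : HoleAt M C u v X) :
    v ≠ m u := by
  have h1 := hc.card_lt h
  have h2 := hc.card_lt h.symm
  have h3 := Finset.card_union_le (colorsAt X u) (colorsAt X v)
  obtain ⟨c, hcc⟩ : ∃ c, c ∉ colorsAt X u ∪ colorsAt X v := by
    by_contra! hall
    have := Finset.card_le_card (s := Finset.univ) (t := colorsAt X u ∪ colorsAt X v)
      (fun c _ => hall c)
    simp at this
    omega
  rw [Finset.mem_union, not_or] at hcc
  rw [Ne, ← hc.partner]
  exact (h.reachable_of_notMem hc.not_colorable hcc.1 hcc.2).2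

theorem IsCounterexample.leads (hc : IsCounterexample M C m) (h : HoleAt M C u v X) {c : Fin 7}
    (hu : c ∉ colorsAt X u) (hv : c ∉ colorsAt X v) : Leads M (X c) u v :=
  (leads_iff_of_free (notMem_colorsAt.1 hu)).2
    (h.reachable_of_notMem hc.not_colorable hu hv).1

theorem IsCounterexample.leads_unique (hc : IsCounterexample M C m) (h : HoleAt M C u v X)
    {c : Fin 7} {z x y : V} (hx : c ∉ colorsAt X x) (hy : c ∉ colorsAt X y) (hxu : x ≠ z)
    (hyu : y ≠ z) (h1 : Leads M (X c) z x) (h2 : Leads M (X c) z y) : x = y :=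
  h1.unique hc.partner (h.coloring.matching c) (notMem_colorsAt.1 hx) (notMem_colorsAt.1 hy)
    hxu hyu h2

theorem IsCounterexample.mem_partner (hc : IsCounterexample M C m)
    {c : Fin 7} {z x : V} (hx : c ∉ colorsAt X x) (hxu : x ≠ z) (hxm : x ≠ m z)
    (h1 : Leads M (X c) z x) : c ∈ colorsAt X (m z) ∧ c ∈ colorsAt X (m x) := by
  simp only [mem_colorsAt]
  exact h1.adj_partner hc.partner (notMem_colorsAt.1 hx) hxu hxm

/-- The hole turns from `uv` to another edge `ux` at `u`. -/
theorem HoleAt.shift (h : HoleAt M C u v X) {a : Fin 7} (hx : (X a).Adj u x)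
    (hv : a ∉ colorsAt X v) (hl : ¬ Leads M (X a) u v) :
    HoleAt M C u x (recolor X a u x u v) := by
  refine h.move hx (fun b hb => by rw [h.coloring.matching _ _ _ _ hx hb])
    (fun b hb => absurd hb (notMem_colorsAt.1 hv b)) fun hr => hl (hr.mono ?_)
  refine sup_le_sup le_rfl fun p q hpq => ?_
  rw [sdiff_adj, adj_edge] at hpq
  rw [deleteIncidenceSet_adj]
  refine ⟨hpq.1, ?_, ?_⟩
  · rintro rfl
    exact hpq.2 ⟨by rw [h.coloring.matching _ _ _ _ hx hpq.1], hpq.1.ne⟩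
  · rintro rfl
    exact hpq.2 ⟨by rw [h.coloring.matching _ _ _ _ hx hpq.1.symm, Sym2.eq_swap], hpq.1.ne⟩

open Classical in
/-- The colours at `u` by which the hole can turn around `u`. -/
noncomputable def shiftable (M : SimpleGraph V) (X : Fin 7 → SimpleGraph V) (u v : V) :
    Finset (Fin 7) :=
  (colorsAt X u).filter fun a => a ∉ colorsAt X v ∧ ¬ Leads M (X a) u v

theorem mem_shiftable {a : Fin 7} : a ∈ shiftable M X u v ↔
    a ∈ colorsAt X u ∧ a ∉ colorsAt X v ∧ ¬ Leads M (X a) u v := by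
  simp [shiftable]

/-- Distinct colours outside `colorsAt X u` are needed at the partner of `u` to block the hole `uv`
and every hole `ux` to which it can turn. Since at most four colours occur there, at most four at `x`
and at most three at `u` and at `v`, all these estimates are equalities. -/
theorem IsCounterexample.count [Finite V] (hc : IsCounterexample M C m) (h : HoleAt M C u v X) :
    (colorsAt X v).card = 3 ∧ (colorsAt X (m u)).card = 4 ∧
    (∀ a ∈ colorsAt X u, a ∈ colorsAt X (m u) → a ∉ colorsAt X v ∧ Leads M (X a) u v) ∧
    (∀ a ∈ shiftable M X u v, ∀ x, (X a).Adj u x →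
      (colorsAt X u ∪ colorsAt X x)ᶜ.card = 1) ∧
    (colorsAt X (m u) \ colorsAt X u).card =
      (colorsAt X u ∪ colorsAt X v)ᶜ.card + (shiftable M X u v).card := by
  classical
  have : Nonempty V := ⟨u⟩
  have hch : ∀ c ∈ colorsAt X u, ∃ y, (X c).Adj u y := fun c hc => mem_colorsAt.1 hc
  choose! x hx using hch
  set S := colorsAt X with hS
  set P := shiftable M X u v with hP
  -- The colours that block the hole `ux` after it has been created by giving the colour `a` to `uv`.
  let K : Fin 7 → Finset (Fin 7) := fun a => (S u ∪ S (x a))ᶜ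
  have hPu : ∀ a ∈ P, a ∈ S u := fun a ha => (mem_shiftable.1 ha).1
  have hu3 : (S u).card ≤ 3 := hc.card_lt h
  have hv3 : (S v).card ≤ 3 := hc.card_lt h.symm
  have hvm := hc.ne_partner h
  have hsh : ∀ a ∈ P, HoleAt M C u (x a) (recolor X a u (x a) u v) := fun a ha =>
    h.shift (hx a (hPu a ha)) (mem_shiftable.1 ha).2.1 (mem_shiftable.1 ha).2.2
  have hKl : ∀ a ∈ P, ∀ c ∈ K a, c ∉ S u ∧ c ∉ S (x a) ∧ Leads M (X c) u (x a) ∧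
      c ∈ S (m u) := by
    intro a ha c hca
    simp only [K, Finset.mem_compl, Finset.mem_union, not_or] at hca
    have hne : c ≠ a := fun e => hca.1 (e ▸ hPu a ha)
    have hl := hc.leads (hsh a ha) (c := c)
      (by rw [h.mem_colorsAt_recolor (hx a (hPu a ha))]; simp [hne, ← hS, hca.1])
      (by rw [h.mem_colorsAt_recolor (hx a (hPu a ha))]; simp [hne, ← hS, hca.2])
    rw [recolor_of_ne hne] at hl
    exact ⟨hca.1, hca.2, hl,
      (hc.mem_partner hca.2 (hsh a ha).ne.symm (hc.ne_partner (hsh a ha)) hl).1⟩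
  have hK1 : ∀ a ∈ P, 1 ≤ (K a).card := by
    intro a ha
    have h1 : (S (x a)).card ≤ 4 := hc.card_le h (x a)
    have h2 := Finset.card_union_add_card_inter (S u) (S (x a))
    have h3 : 0 < (S u ∩ S (x a)).card := Finset.card_pos.2
      ⟨a, Finset.mem_inter.2 ⟨hPu a ha, mem_colorsAt.2 ⟨u, (hx a (hPu a ha)).symm⟩⟩⟩
    simp only [K, Finset.card_compl, Fintype.card_fin]
    omega
  have hsub : (S u ∪ S v)ᶜ ∪ P.biUnion K ⊆ S (m u) \ S u := by
    intro c hcc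
    rw [Finset.mem_sdiff]
    rcases Finset.mem_union.1 hcc with hcc | hcc
    · simp only [Finset.mem_compl, Finset.mem_union, not_or] at hcc
      exact ⟨(hc.mem_partner hcc.2 h.ne.symm hvm (hc.leads h hcc.1 hcc.2)).1, hcc.1⟩
    · obtain ⟨a, ha, hca⟩ := Finset.mem_biUnion.1 hcc
      exact ⟨(hKl a ha c hca).2.2.2, (hKl a ha c hca).1⟩
  have hd1 : Disjoint (S u ∪ S v)ᶜ (P.biUnion K) := by
    rw [Finset.disjoint_left]
    intro c hcc hcc'
    obtain ⟨a, ha, hca⟩ := Finset.mem_biUnion.1 hcc'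
    simp only [Finset.mem_compl, Finset.mem_union, not_or] at hcc
    obtain ⟨h1, h2, h3, -⟩ := hKl a ha c hca
    exact h.ne_of_adj (hx a (hPu a ha)) (hc.leads_unique h h2 hcc.2 (hsh a ha).ne.symm h.ne.symm h3
      (hc.leads h hcc.1 hcc.2))
  have hd2 : (P : Set (Fin 7)).PairwiseDisjoint K := by
    intro a ha b hb hab
    rw [Function.onFun, Finset.disjoint_left]
    intro c hca hcb
    obtain ⟨h1, h2, h3, -⟩ := hKl a ha c hca
    obtain ⟨h4, h5, h6, -⟩ := hKl b hb c hcb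
    have := hc.leads_unique h h2 h5 (hsh a ha).ne.symm (hsh b hb).ne.symm h3 h6
    exact hab (h.coloring.color_unique _ _ _ _ (hx a (hPu a ha)) (this ▸ hx b (hPu b hb)))
  have hcard := Finset.card_le_card hsub
  rw [Finset.card_union_of_disjoint hd1, Finset.card_biUnion hd2] at hcard
  have hsum : P.card ≤ ∑ a ∈ P, (K a).card := by
    simpa using Finset.sum_le_sum hK1
  -- Every colour at `u` occurs at `v`, or is shiftable, or belongs to `N`.
  set N := (S u).filter fun a => a ∉ S v ∧ Leads M (X a) u v with hN
  have hNsub : N ⊆ S u ∩ S (m u) := by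
    intro a ha
    obtain ⟨h1, h2, h3⟩ := Finset.mem_filter.1 ha
    exact Finset.mem_inter.2 ⟨h1, (hc.mem_partner h2 h.ne.symm hvm h3).1⟩
  have hNc := Finset.card_le_card hNsub
  have hpart : (S u).card = (S u ∩ S v).card + P.card + N.card := by
    have h1 : S u = (S u ∩ S v) ∪ (P ∪ N) := by
      ext a
      simp only [hP, hN, shiftable, Finset.mem_union, Finset.mem_inter, Finset.mem_filter]
      tauto
    have h2 : Disjoint P N := by
      rw [Finset.disjoint_left]
      simp only [hP, hN, shiftable, Finset.mem_filter]
      tauto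
    have h3 : Disjoint (S u ∩ S v) (P ∪ N) := by
      rw [Finset.disjoint_left]
      simp only [hP, hN, shiftable, Finset.mem_filter, Finset.mem_union, Finset.mem_inter]
      tauto
    conv_lhs => rw [h1]
    rw [Finset.card_union_of_disjoint h3, Finset.card_union_of_disjoint h2, add_assoc]
  have hm4 : (S (m u)).card ≤ 4 := hc.card_le h (m u)
  have hsd := Finset.card_sdiff_add_card_inter (S (m u)) (S u)
  rw [Finset.inter_comm] at hsd
  have hui := Finset.card_union_add_card_inter (S u) (S v)
  have hW : (S u ∪ S v)ᶜ.card = 7 - (S u ∪ S v).card := by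
    rw [Finset.card_compl, Fintype.card_fin]
  have hNeq : N = S u ∩ S (m u) := Finset.eq_of_subset_of_card_le hNsub (by omega)
  have hsumeq : ∑ a ∈ P, (K a).card = P.card := by omega
  refine ⟨by omega, by omega, ?_, ?_, by omega⟩
  · intro a ha ha'
    have : a ∈ N := hNeq ▸ Finset.mem_inter.2 ⟨ha, ha'⟩
    exact (Finset.mem_filter.1 this).2
  · intro a ha y hy
    obtain rfl := h.coloring.matching _ _ _ _ hy (hx a (hPu a ha))
    have := (Finset.sum_eq_sum_iff_of_le hK1).1 (by simpa using hsumeq.symm) a ha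
    exact this.symm

/-- The hole `uv` cannot turn around `u`: all paths that start at the partner of `u` lead
to `v`. -/
def IsBlockedAt (M : SimpleGraph V) (m : V → V) (X : Fin 7 → SimpleGraph V) (u v : V) : Prop :=
  ∀ c ∈ colorsAt X (m u), c ∉ colorsAt X v ∧ Leads M (X c) u v

/-- The colours missing at `u` are those at its partner, and no colour occurs at both ends of
the hole `uv`. The hole can then turn to any other edge at `u`. -/
def IsTightAt (m : V → V) (X : Fin 7 → SimpleGraph V) (u v : V) : Prop :=
  colorsAt X (m u) = (colorsAt X u)ᶜ ∧ Disjoint (colorsAt X u) (colorsAt X v)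

theorem IsCounterexample.notMem_partner_of_shiftable (hc : IsCounterexample M C m)
    {a : Fin 7} (hm : Disjoint (colorsAt X u) (colorsAt X (m u))) (huv : u ≠ v) (hvm : v ≠ m u)
    (ha : a ∈ colorsAt X u) (hav : a ∉ colorsAt X v) : a ∈ shiftable M X u v := by
  refine mem_shiftable.2 ⟨ha, hav, fun hl => ?_⟩
  exact Finset.disjoint_left.1 hm ha (hc.mem_partner hav huv.symm hvm hl).1

/-- If the hole `uv` can turn to `ux`, then the counts for `uv` and for `ux` together leave no
colour that occurs at `u` and also at the partner of `u` or at `v`. -/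
theorem IsCounterexample.isTightAt_of_shiftable [Finite V] (hc : IsCounterexample M C m)
    (h : HoleAt M C u v X) {a : Fin 7} (ha : a ∈ shiftable M X u v) : IsTightAt m X u v := by
  obtain ⟨hau, hav, hal⟩ := mem_shiftable.1 ha
  obtain ⟨x, hx⟩ := mem_colorsAt.1 hau
  have h' := h.shift hx hav hal
  obtain ⟨hv3, hm4, hN, -, -⟩ := hc.count h
  have hu3 := (hc.count h.symm).1
  obtain ⟨-, -, hN', hK', -⟩ := hc.count h'
  have hS := fun d z => h.mem_colorsAt_recolor (d := d) (z := z) hx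
  have hxv := h.ne_of_adj hx
  have hvm := hc.ne_partner h
  have hxm := hc.ne_partner h'
  have hmu := partner_ne hc.partner u
  have hSu : colorsAt (recolor X a u x u v) u = colorsAt X u := by
    ext d
    simp only [hS, true_or, and_true]
    grind
  have hSm : colorsAt (recolor X a u x u v) (m u) = colorsAt X (m u) := by
    ext d
    simp only [hS, hvm.symm, hmu]
    grind
  have hSv : colorsAt (recolor X a u x u v) v = insert a (colorsAt X v) := by
    ext d
    simp only [hS, Finset.mem_insert]
    grind
  have hdisj : Disjoint (colorsAt X u) (colorsAt X (m u)) := by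
    rw [Finset.disjoint_left]
    intro b hb hbm
    have hba : b ≠ a := by
      rintro rfl
      exact hal (hN b hb hbm).2
    obtain ⟨h1, h2⟩ := hN' b (hSu ▸ hb) (hSm ▸ hbm)
    rw [recolor_of_ne hba] at h2
    have h3 : b ∉ colorsAt X x := fun hbx => h1 ((hS b x).2 (.inl ⟨hba, hbx⟩))
    exact hxv (hc.leads_unique h h3 (hN b hb hbm).1 h'.ne.symm h.ne.symm h2 (hN b hb hbm).2)
  refine ⟨?_, ?_⟩
  · refine Finset.eq_of_subset_of_card_le ?_ ?_
    · intro b hb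
      exact Finset.mem_compl.2 fun hb' => Finset.disjoint_left.1 hdisj hb' hb
    · rw [Finset.card_compl, Fintype.card_fin]
      omega
  -- The hole can turn back from `ux` to `uv`, so exactly one colour is missing at `u` and `v`.
  · have ha' : a ∈ shiftable M (recolor X a u x u v) u x := by
      refine hc.notMem_partner_of_shiftable (by rwa [hSu, hSm]) h'.ne hxm (hSu ▸ hau) ?_
      rw [hS]
      have := h'.ne
      grind
    have hk := hK' a ha' v (by rw [recolor_adj h.ne]; simp)
    rw [hSu, hSv, Finset.union_insert, Finset.insert_eq_of_mem (Finset.mem_union_left _ hau),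
      Finset.card_compl, Fintype.card_fin] at hk
    have := Finset.card_union_add_card_inter (colorsAt X u) (colorsAt X v)
    rw [Finset.disjoint_iff_inter_eq_empty, ← Finset.card_eq_zero]
    omega

theorem IsCounterexample.blocked_or_tight [Finite V] (hc : IsCounterexample M C m)
    (h : HoleAt M C u v X) :
    IsBlockedAt M m X u v ∨ IsTightAt m X u v := by
  rcases (shiftable M X u v).eq_empty_or_nonempty with hP | ⟨a, ha⟩
  · left
    obtain ⟨-, -, hN, -, hW⟩ := hc.count h
    have hWeq : (colorsAt X u ∪ colorsAt X v)ᶜ = colorsAt X (m u) \ colorsAt X u := by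
      refine Finset.eq_of_subset_of_card_le ?_ (by simp [hW, hP])
      intro c hcc
      simp only [Finset.mem_compl, Finset.mem_union, not_or] at hcc
      exact Finset.mem_sdiff.2 ⟨(hc.mem_partner hcc.2 h.ne.symm (hc.ne_partner h)
        (hc.leads h hcc.1 hcc.2)).1, hcc.1⟩
    intro c hcm
    by_cases hcu : c ∈ colorsAt X u
    · exact hN c hcu hcm
    · have : c ∈ (colorsAt X u ∪ colorsAt X v)ᶜ := hWeq ▸ Finset.mem_sdiff.2 ⟨hcm, hcu⟩
      simp only [Finset.mem_compl, Finset.mem_union, not_or] at this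
      exact ⟨this.2, hc.leads h this.1 this.2⟩
  · exact .inr (hc.isTightAt_of_shiftable h ha)

/-! ### Existence of a tight hole -/

/-- A colour `c` missing at both ends of the hole `uv` closes an alternating cycle with `uv`. The
hole can move along this cycle to the next edge of colour `c`, at the partner of `u`. -/
theorem IsCounterexample.rotate [Finite V] (hc : IsCounterexample M C m) (h : HoleAt M C u v X)
    {c : Fin 7} {y : V} (hu : c ∉ colorsAt X u) (hv : c ∉ colorsAt X v)
    (hy : (X c).Adj (m u) y) : HoleAt M C (m u) y (recolor X c (m u) y u v) := by
  rw [notMem_colorsAt] at hu hv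
  refine h.move hy (fun b hb => absurd hb (hu b)) (fun b hb => absurd hb (hv b)) fun hr => ?_
  have := mem_of_reachable_of_closed (S := {u, m u}) ?_ (by simp) hr
  · rcases this with e | e
    exacts [h.ne e.symm, hc.ne_partner h e]
  · rintro a (rfl | rfl) b
    · simp +contextual [hc.partner, hu]
    · rw [sup_adj, sdiff_adj, adj_edge, hc.partner, partner_partner hc.partner]
      rintro (rfl | ⟨h1, h2⟩)
      · simp
      · obtain rfl := h.coloring.matching _ _ _ _ hy h1
        exact absurd ⟨rfl, h1.ne⟩ h2

/-- After the move of `rotate`, if the new hole is blocked at the partner of `u`, then the paths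
of the colours at `u` lead from this partner to the other end of the new hole. -/
theorem IsCounterexample.leads_of_rotate_blocked [Finite V] (hc : IsCounterexample M C m)
    (h : HoleAt M C u v X) {c d : Fin 7} {y : V} (hu : c ∉ colorsAt X u)
    (hy : (X c).Adj (m u) y)
    (hb : IsBlockedAt M m (recolor X c (m u) y u v) (m u) y) (hd : d ∈ colorsAt X u) :
    d ∉ colorsAt X y ∧ Leads M (X d) (m u) y := by
  have hdc : d ≠ c := fun e => hu (e ▸ hd)
  have := hb d (by
    rw [partner_partner hc.partner, h.mem_colorsAt_recolor hy]
    exact .inl ⟨hdc, hd⟩)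
  rw [recolor_of_ne hdc] at this
  exact ⟨fun e => this.1 ((h.mem_colorsAt_recolor hy).2 (.inl ⟨hdc, e⟩)), this.2⟩

theorem IsCounterexample.partner_eq_compl_of_blocked [Finite V] (hc : IsCounterexample M C m)
    (h : HoleAt M C u v X) (hb : IsBlockedAt M m X u v) :
    colorsAt X (m u) = (colorsAt X v)ᶜ := by
  obtain ⟨hv3, hm4, -⟩ := hc.count h
  refine Finset.eq_of_subset_of_card_le ?_ ?_
  · exact fun c hcc => Finset.mem_compl.2 (hb c hcc).1
  · rw [Finset.card_compl, Fintype.card_fin]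
    omega

theorem IsTightAt.mem_shiftable (hc : IsCounterexample M C m) (ht : IsTightAt m X u v)
    (huv : u ≠ v) (hvm : v ≠ m u) {b : Fin 7} (hb : b ∈ colorsAt X u) :
    b ∈ shiftable M X u v := by
  refine hc.notMem_partner_of_shiftable ?_ huv hvm hb (Finset.disjoint_left.1 ht.2 hb)
  rw [ht.1]
  exact disjoint_compl_right

/-- A hole `uv` is not blocked at `u` and tight at `v`. Otherwise, after a rotation to a hole at the
partner of `u` with other end `y`, all colours at `u` lead from `v` to `y`; but by tightness at
`v` some of them lead from `v` to the other ends of the edges at `v`. -/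
theorem IsCounterexample.not_tight_of_blocked [Finite V] (hc : IsCounterexample M C m)
    (h : HoleAt M C u v X) (hb : IsBlockedAt M m X u v) (ht : IsTightAt m X v u) : False := by
  have hmu := hc.partner_eq_compl_of_blocked h hb
  have hv3 := (hc.count h).1
  have hu3 := (hc.count h.symm).1
  have hvu := hc.ne_partner h.symm
  obtain ⟨c, hcc⟩ : (colorsAt X u ∪ colorsAt X v)ᶜ.Nonempty := by
    rw [← Finset.card_pos, Finset.card_compl, Fintype.card_fin]
    have := Finset.card_union_le (colorsAt X u) (colorsAt X v)
    omega
  simp only [Finset.mem_compl, Finset.mem_union, not_or] at hcc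
  obtain ⟨y, hy⟩ := mem_colorsAt.1 (show c ∈ colorsAt X (m u) by simp [hmu, hcc.2])
  have h' := hc.rotate h hcc.1 hcc.2 hy
  have hyv : y ≠ v := by
    rintro rfl
    exact hcc.2 (mem_colorsAt.2 ⟨_, hy.symm⟩)
  -- Every colour at `u` leads from `v` to the end `y` of the rotated hole.
  have key : ∀ d ∈ colorsAt X u, d ∉ colorsAt X y ∧ Leads M (X d) v y := by
    intro d hd
    have hdv : d ∉ colorsAt X v := Finset.disjoint_right.1 ht.2 hd
    have hdm : d ∈ colorsAt X (m u) := by simp [hmu, hdv]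
    have hdc : d ≠ c := fun e => hcc.1 (e ▸ hd)
    rcases hc.blocked_or_tight h' with hb' | ht'
    · obtain ⟨h1, h2⟩ := hc.leads_of_rotate_blocked h hcc.1 hy hb' hd
      refine ⟨h1, (leads_iff_of_free (notMem_colorsAt.1 hdv)).2 ?_⟩
      have h3 : (M ⊔ X d).Adj u (m u) := .inl ((hc.partner _ _).2 rfl)
      exact (hb d hdm).2.reachable.symm.trans (h3.reachable.trans h2.reachable)
    · have h1 := ht'.1
      rw [partner_partner hc.partner] at h1
      have h2 : d ∈ colorsAt (recolor X c (m u) y u v) u :=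
        (h.mem_colorsAt_recolor hy).2 (.inl ⟨hdc, hd⟩)
      rw [h1, Finset.mem_compl] at h2
      exact absurd ((h.mem_colorsAt_recolor hy).2 (.inl ⟨hdc, hdm⟩)) h2
  -- But the hole turns to every edge at `v`, and a colour at `u` leads to its other end.
  have hall : ∀ b ∈ colorsAt X v, (X b).Adj v y := by
    intro b hbv
    have hs := ht.mem_shiftable hc h.ne.symm hvu hbv
    obtain ⟨z, hz⟩ := mem_colorsAt.1 hbv
    have hz' := h.symm.shift hz (Bandpass.mem_shiftable.1 hs).2.1
      (Bandpass.mem_shiftable.1 hs).2.2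
    obtain ⟨k, hk⟩ : (colorsAt X v ∪ colorsAt X z)ᶜ.Nonempty := by
      rw [← Finset.card_pos, (hc.count h.symm).2.2.2.1 b hs z hz]
      exact one_pos
    simp only [Finset.mem_compl, Finset.mem_union, not_or] at hk
    have hkb : k ≠ b := fun e => hk.1 (e ▸ hbv)
    have hzu := h.symm.ne_of_adj hz
    have hl := hc.leads hz' (c := k)
      (by rw [h.symm.mem_colorsAt_recolor hz]; simp [hkb, hk.1])
      (by rw [h.symm.mem_colorsAt_recolor hz]; simp [hkb, hk.2])
    rw [recolor_of_ne hkb] at hl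
    by_cases hku : k ∈ colorsAt X u
    · have := hc.leads_unique h hk.2 (key k hku).1 hz'.ne.symm hyv hl (key k hku).2
      exact this ▸ hz
    · exact absurd (hc.leads_unique h hk.2 hku hz'.ne.symm h.ne hl
        (hc.leads h.symm hk.1 hku)) hzu
  obtain ⟨b, hbv, b', hbv', hne⟩ := Finset.one_lt_card.1 (by omega : 1 < (colorsAt X v).card)
  exact hne (h.coloring.color_unique _ _ _ _ (hall b hbv) (hall b' hbv'))

/-- If a hole `uv` is blocked at both ends, then every colour at the partner of `u` allows a
rotation, and for two different colours the new holes cannot both be blocked: a colour at `u` would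
lead from the partner of `u` to the ends of both. -/
theorem IsCounterexample.exists_tight [Finite V] (hc : IsCounterexample M C m)
    (h : HoleAt M C u v X) : ∃ u v X, HoleAt M C u v X ∧ IsTightAt m X u v := by
  by_contra! hno
  have hb := (hc.blocked_or_tight h).resolve_right (hno _ _ _ h)
  have hb' := (hc.blocked_or_tight h.symm).resolve_right (hno _ _ _ h.symm)
  have hmu := hc.partner_eq_compl_of_blocked h hb
  have hmv := hc.partner_eq_compl_of_blocked h.symm hb'
  have hm4 := (hc.count h).2.1
  have hu3 := (hc.count h.symm).1
  have hfree : ∀ c ∈ colorsAt X (m u), c ∉ colorsAt X u ∧ c ∉ colorsAt X v := by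
    intro c hcm
    obtain ⟨h1, h2⟩ := hb c hcm
    have h3 := (hc.mem_partner h1 h.ne.symm (hc.ne_partner h) h2).2
    rw [hmv, Finset.mem_compl] at h3
    exact ⟨h3, h1⟩
  obtain ⟨a, ha⟩ := Finset.card_pos.1 (by omega : 0 < (colorsAt X u).card)
  have key : ∀ c ∈ colorsAt X (m u), ∃ y, (X c).Adj (m u) y ∧ a ∉ colorsAt X y ∧
      Leads M (X a) (m u) y := by
    intro c hcm
    obtain ⟨y, hy⟩ := mem_colorsAt.1 hcm
    have h' := hc.rotate h (hfree c hcm).1 (hfree c hcm).2 hy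
    exact ⟨y, hy, hc.leads_of_rotate_blocked h (hfree c hcm).1 hy
      ((hc.blocked_or_tight h').resolve_right (hno _ _ _ h')) ha⟩
  obtain ⟨c, hcm, c', hcm', hne⟩ :=
    Finset.one_lt_card.1 (by omega : 1 < (colorsAt X (m u)).card)
  obtain ⟨y, hy, h1, h2⟩ := key c hcm
  obtain ⟨y', hy', h3, h4⟩ := key c' hcm'
  obtain rfl := hc.leads_unique h h1 h3 hy.ne.symm hy'.ne.symm h2 h4
  exact hne (h.coloring.color_unique _ _ _ _ hy hy')

theorem IsCounterexample.tight_symm [Finite V] (hc : IsCounterexample M C m)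
    (h : HoleAt M C u v X) (ht : IsTightAt m X u v) : IsTightAt m X v u :=
  (hc.blocked_or_tight h.symm).resolve_left fun hb => hc.not_tight_of_blocked h.symm hb ht

/-! ### The travels of a tight hole -/

/-- A tight hole `uv` turns to any other edge `vw` at `v` and remains tight. -/
theorem IsCounterexample.turn [Finite V] (hc : IsCounterexample M C m) (h : HoleAt M C u v X)
    (ht : IsTightAt m X u v) {w : V} (hw : C.Adj v w) (hwu : w ≠ u) :
    ∃ X' r, HoleAt M C v w X' ∧ IsTightAt m X' v w ∧ (X r).Adj v w ∧ (X' r).Adj v u ∧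
      ∀ c a b, s(a, b) ≠ s(u, v) → s(a, b) ≠ s(v, w) → ((X' c).Adj a b ↔ (X c).Adj a b) := by
  have ht' := hc.tight_symm h ht
  obtain ⟨r, hr⟩ := (h.adj_iff v w).2 ⟨hw, by
    rw [Sym2.eq_swap, Ne, Sym2.congr_right]; exact hwu.symm⟩
  have hrv : r ∈ colorsAt X v := mem_colorsAt.2 ⟨w, hr⟩
  have hru : r ∉ colorsAt X u := Finset.disjoint_left.1 ht'.2 hrv
  have hum := hc.ne_partner h.symm
  have hs := Bandpass.mem_shiftable.1 (ht'.mem_shiftable hc h.ne.symm hum hrv)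
  have h' := h.symm.shift hr hs.2.1 hs.2.2
  have hS := fun d z => h.symm.mem_colorsAt_recolor (d := d) (z := z) hr
  have hwm := hc.ne_partner h'
  have hwv := h'.ne
  have hmv := partner_ne hc.partner v
  have hSv : colorsAt (recolor X r v w v u) v = colorsAt X v := by
    ext d
    simp only [hS, true_or, and_true]
    grind
  have hSm : colorsAt (recolor X r v w v u) (m v) = colorsAt X (m v) := by
    ext d
    simp only [hS, hmv, hum.symm]
    grind
  refine ⟨recolor X r v w v u, r, h', ?_, hr, by rw [recolor_adj h.ne.symm]; simp, ?_⟩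
  · refine hc.isTightAt_of_shiftable h' (a := r)
      (hc.notMem_partner_of_shiftable ?_ hwv hwm (hSv ▸ hrv) ?_)
    · rw [hSv, hSm, ht'.1]
      exact disjoint_compl_right
    · rw [hS]
      grind
  · intro c a b h1 h2
    rw [recolor_adj h.ne.symm]
    simp [h2.symm, Sym2.eq_swap (a := v) (b := u), h1.symm]

/-- A tight hole travels along any walk. Edges at vertices that the walk avoids keep their
colours. -/
theorem IsCounterexample.travel [Finite V] (hc : IsCounterexample M C m) (A : Set V)
    {a s t : V} (h : HoleAt M C a s X) (ht : IsTightAt m X a s) (ha : a ∉ A) (hs : s ∉ A)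
    (hst : Relation.ReflTransGen (fun x y => C.Adj x y ∧ y ∉ A) s t) :
    ∃ b X', HoleAt M C b t X' ∧ IsTightAt m X' b t ∧ b ∉ A ∧ t ∉ A ∧
      ∀ c, ∀ z ∈ A, ∀ y, (X' c).Adj z y ↔ (X c).Adj z y := by
  induction hst with
  | refl => exact ⟨a, X, h, ht, ha, hs, fun _ _ _ _ => Iff.rfl⟩
  | @tail t t' _ htt' ih =>
    obtain ⟨b, X', h1, h2, h3, h4, h5⟩ := ih
    by_cases hb : t' = b
    · subst hb
      exact ⟨t, X', h1.symm, hc.tight_symm h1 h2, h4, h3, h5⟩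
    · obtain ⟨X'', r, h6, h7, -, -, h8⟩ := hc.turn h1 h2 htt'.1 hb
      refine ⟨t, X'', h6, h7, h4, htt'.2, fun c z hz y => ?_⟩
      rw [← h5 c z hz y]
      have hzb : z ≠ b := fun e => h3 (e ▸ hz)
      have hzt : z ≠ t := fun e => h4 (e ▸ hz)
      have hzt' : z ≠ t' := fun e => htt'.2 (e ▸ hz)
      refine h8 c z y ?_ ?_ <;> rw [Ne, Sym2.eq_iff] <;> tauto

/-- A tight hole cannot travel around a cycle through `p` that avoids the partner of `p`: the
colours at `p` would change and those at its partner would not. -/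
theorem IsCounterexample.not_closed_walk [Finite V] (hc : IsCounterexample M C m) {p s t : V}
    (h : HoleAt M C p s X) (ht : IsTightAt m X p s) (hpt : C.Adj p t) (hne : s ≠ t)
    (hst : Relation.ReflTransGen (fun x y => C.Adj x y ∧ y ∉ ({p, m p} : Set V)) s t) :
    False := by
  rcases Relation.ReflTransGen.cases_head hst with e | ⟨w, ⟨hsw, hwA⟩, hwt⟩
  · exact hne e
  have hsm := hc.ne_partner h
  have hmp := partner_ne hc.partner p
  simp only [Set.mem_insert_iff, Set.mem_singleton_iff, not_or] at hwA
  obtain ⟨X₁, r, h1, ht1, hr, hr1, hX1⟩ := hc.turn h ht hsw hwA.1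
  obtain ⟨b, X₂, h2, ht2, hbA, htA, hX2⟩ := hc.travel {p, m p} h1 ht1
    (by simp [h.ne.symm, hsm]) (by simp [hwA]) hwt
  simp only [Set.mem_insert_iff, Set.mem_singleton_iff, not_or] at hbA htA
  obtain ⟨X₃, -, h3, ht3, -, -, hX3⟩ := hc.turn h2 ht2 hpt.symm (Ne.symm hbA.1)
  have hrp : r ∈ colorsAt X₃ p := by
    refine mem_colorsAt.2 ⟨s, ?_⟩
    rw [hX3, hX2 _ _ (by simp)]
    · exact hr1.symm
    · rw [Ne, Sym2.eq_iff]
      have := hbA.1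
      have := htA.1
      grind
    · rw [Ne, Sym2.eq_iff]
      have := htA.1
      grind
  have hrm : r ∈ colorsAt X₃ (m p) := by
    have : r ∈ colorsAt X (m p) := by
      rw [ht.1, Finset.mem_compl]
      exact Finset.disjoint_right.1 ht.2 (mem_colorsAt.2 ⟨w, hr⟩)
    obtain ⟨z, hz⟩ := mem_colorsAt.1 this
    refine mem_colorsAt.2 ⟨z, ?_⟩
    rw [hX3, hX2 _ _ (by simp), hX1]
    · exact hz
    all_goals
      rw [Ne, Sym2.eq_iff]
      have := hbA.2
      have := htA.2
      have := hwA.2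
      grind
  have := (hc.tight_symm h3 ht3).1
  rw [this, Finset.mem_compl] at hrm
  exact hrm hrp

theorem exists_longest_path [Finite V] (C : SimpleGraph V) (v : V) :
    ∃ t, ∃ p : C.Walk v t, p.IsPath ∧
      ∀ t', ∀ q : C.Walk v t', q.IsPath → q.length ≤ p.length := by
  have := Fintype.ofFinite V
  let L : Set ℕ := {k | ∃ t, ∃ p : C.Walk v t, p.IsPath ∧ p.length = k}
  have hb : BddAbove L := ⟨Fintype.card V, by
    rintro k ⟨t, p, hp, rfl⟩
    exact hp.length_lt.le⟩
  obtain ⟨t, p, hp, hpl⟩ := Nat.sSup_mem (s := L) ⟨0, v, .nil, by simp, rfl⟩ hb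
  exact ⟨t, p, hp, fun t' q hq => hpl ▸ le_csSup hb ⟨t', q, hq, rfl⟩⟩

/-- The end `t` of a longest path has four neighbours on the path. Two of them are on the same
side of the partner of `t`, and a tight hole could travel around the cycle that they close. -/
theorem IsCounterexample.false_of_tight [Finite V] (hc : IsCounterexample M C m)
    (h : HoleAt M C u v X) (ht : IsTightAt m X u v) : False := by
  classical
  obtain ⟨t, p, hp, hmax⟩ := exists_longest_path C v
  have hreach : Relation.ReflTransGen (fun x y => C.Adj x y ∧ y ∉ (∅ : Set V)) v t := by
    simpa [SimpleGraph.reachable_iff_reflTransGen] using p.reachable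
  obtain ⟨b, Y, hY, htY, -, -, -⟩ := hc.travel ∅ h ht (by simp) (by simp) hreach
  have hhole : ∀ n, C.Adj t n → ∃ Z, HoleAt M C t n Z ∧ IsTightAt m Z t n := by
    intro n hn
    by_cases hnb : n = b
    · subst hnb
      exact ⟨Y, hY.symm, hc.tight_symm hY htY⟩
    · obtain ⟨Z, -, h1, h2, -⟩ := hc.turn hY htY hn hnb
      exact ⟨Z, h1, h2⟩
  have hidx : ∀ n, C.Adj t n → ∃ i, i < p.length ∧ p.getVert i = n := by
    intro n hn
    have hmem : n ∈ p.support := by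
      by_contra hnp
      have := hmax n (p.concat hn) (hp.concat hnp hn)
      simp at this
    obtain ⟨i, hi, hle⟩ := Walk.mem_support_iff_exists_getVert.1 hmem
    refine ⟨i, lt_of_le_of_ne hle ?_, hi⟩
    rintro rfl
    rw [Walk.getVert_length] at hi
    exact hn.ne hi
  have : Nonempty ℕ := ⟨0⟩
  choose! f hf hfn using hidx
  obtain ⟨k, hk⟩ : ∃ k, ∀ j ≤ p.length, p.getVert j = m t → j = k := by
    by_cases hex : ∃ j ≤ p.length, p.getVert j = m t
    · obtain ⟨k, hk, hkm⟩ := hex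
      exact ⟨k, fun j hj hjm => hp.getVert_injOn hj hk (hjm.trans hkm.symm)⟩
    · exact ⟨0, fun j hj hjm => (hex ⟨j, hj, hjm⟩).elim⟩
  have key : ∀ n n', C.Adj t n → C.Adj t n' → f n < f n' → (f n < k ↔ f n' < k) → False := by
    intro n n' hn hn' hlt hside
    obtain ⟨Z, hZ, htZ⟩ := hhole n hn
    refine hc.not_closed_walk hZ htZ hn' (by rintro rfl; exact hlt.false) ?_
    have hstep : ∀ j, f n ≤ j → j ≤ f n' →
        Relation.ReflTransGen (fun x y => C.Adj x y ∧ y ∉ ({t, m t} : Set V)) n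
          (p.getVert j) := by
      intro j hj
      induction j, hj using Nat.le_induction with
      | base => intro _; rw [hfn n hn]
      | succ j hj ih =>
        intro hj'
        have hl := hf n' hn'
        refine (ih (by omega)).tail ⟨p.adj_getVert_succ (by omega), ?_⟩
        simp only [Set.mem_insert_iff, Set.mem_singleton_iff, not_or]
        constructor
        · intro e
          rw [hp.getVert_eq_end_iff (by omega)] at e
          omega
        · intro e
          have := hk _ (by omega) e
          omega
    have := hstep (f n') hlt.le le_rfl
    rwa [hfn n' hn'] at this
  have hN : 2 < (C.neighborSet t).toFinite.toFinset.card := by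
    have h1 := hY.symm.card_colorsAt_lt
    have h2 := (hc.count hY).1
    rw [Set.ncard_eq_toFinset_card _ (Set.toFinite _)] at h1
    omega
  obtain ⟨n, hn, n', hn', hne, he⟩ := Finset.exists_ne_map_eq_of_card_lt_of_maps_to
    (t := (Finset.univ : Finset Bool)) (f := fun n => decide (f n < k)) (by simpa using hN)
    (fun _ _ => Finset.mem_univ _)
  simp only [Set.Finite.mem_toFinset, mem_neighborSet, decide_eq_decide] at hn hn' he
  rcases lt_trichotomy (f n) (f n') with hlt | heq | hlt
  · exact key n n' hn hn' hlt he
  · exact hne (by rw [← hfn n hn, ← hfn n' hn', heq])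
  · exact key n' n hn' hn hlt he.symm

theorem isAcyclic_of_partner (hm : ∀ u x, M.Adj u x ↔ x = m u) : M.IsAcyclic := by
  rw [isAcyclic_iff_forall_adj_isBridge]
  intro u x hux
  rw [isBridge_iff]
  intro hr
  have := mem_of_reachable_of_closed (S := {u}) ?_ rfl hr
  · exact hux.ne this.symm
  · rintro a rfl b hab
    rw [deleteEdges_adj] at hab
    exact absurd (by simp [(hm _ _).1 hab.1, (hm _ _).1 hux]) hab.2

/-- The edges of a graph of maximum degree at most four can be partitioned into seven matchings,
none of which closes a cycle with a given perfect matching. -/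
theorem exists_isAcyclicColoring [Finite V] (hm : ∀ u x, M.Adj u x ↔ x = m u)
    (hC : ∀ z, (C.neighborSet z).ncard ≤ 4) : ∃ X, IsAcyclicColoring M C X := by
  induction C using WellFoundedLT.induction with
  | ind C ih =>
  by_contra! hno
  have hc : IsCounterexample M C m := ⟨hm, hC, hno⟩
  by_cases hbot : C = ⊥
  · refine hno (fun _ => ⊥) ⟨?_, ?_, ?_, ?_⟩
    · simp [hbot]
    · simp
    · simp
    · simpa using isAcyclic_of_partner hm
  · obtain ⟨u, v, huv⟩ := ne_bot_iff_exists_adj.1 hbot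
    obtain ⟨X, hX⟩ := ih (C \ edge u v)
      (sdiff_le.lt_of_not_ge fun hle => (hle huv).2 (by simp [adj_edge, huv.ne])) fun z =>
        (Set.ncard_le_ncard (fun y hy => hy.1) (Set.toFinite _)).trans (hC z)
    obtain ⟨u', v', X', h, ht⟩ := hc.exists_tight ⟨huv, hX⟩
    exact hc.false_of_tight h ht

end Critical

/-! ### The paired strips of length two -/

section PairedStrips

variable {n m : ℕ}

/-- The rows `a` and `b` are next to each other in the permutation `π`. -/
def AreConsecutive (π : Equiv.Perm (Fin n)) (a b : Fin n) : Prop :=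
  (π.symm a : ℕ) + 1 = π.symm b ∨ (π.symm b : ℕ) + 1 = π.symm a

theorem AreConsecutive.symm {π : Equiv.Perm (Fin n)} {a b : Fin n} (h : AreConsecutive π a b) :
    AreConsecutive π b a := Or.symm h

theorem ncard_areConsecutive_le (π : Equiv.Perm (Fin n)) (a : Fin n) :
    {b | AreConsecutive π a b}.ncard ≤ 2 := by
  have h : ({(π.symm a : ℕ) + 1, (π.symm a : ℕ) - 1} : Set ℕ).ncard ≤ 2 :=
    (Set.ncard_insert_le _ _).trans (by simp)
  refine (Set.ncard_le_ncard_of_injOn (fun b => (π.symm b : ℕ)) ?_ ?_ (by simp)).trans h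
  · intro b hb
    simp only [AreConsecutive, Set.mem_ofPred_eq] at hb
    simp only [Set.mem_insert_iff, Set.mem_singleton_iff]
    omega
  · intro b _ b' _ e
    exact π.symm.injective (Fin.ext e)

/-- The graph of the pairs of rows `i, l` that have, next to them in the permutation `π`, rows `j`
and `k` respectively that are matched by `M`. -/
def linkGraph (π : Equiv.Perm (Fin n)) (M : SimpleGraph (Fin n)) : SimpleGraph (Fin n) where
  Adj i l := i ≠ l ∧ ∃ j k, AreConsecutive π i j ∧ M.Adj j k ∧ AreConsecutive π k l
  symm := ⟨fun _ _ ⟨h, j, k, h1, h2, h3⟩ => ⟨h.symm, k, j, h3.symm, h2.symm, h1.symm⟩⟩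
  loopless := ⟨fun _ h => h.1 rfl⟩

theorem isBMatching_linkGraph (π : Equiv.Perm (Fin n)) {M : SimpleGraph (Fin n)}
    {f : Fin n → Fin n} (hf : ∀ u x, M.Adj u x ↔ x = f u) : IsBMatching 4 (linkGraph π M) := by
  classical
  intro i
  refine ⟨Set.toFinite _, ?_⟩
  have hcard : ∀ a, (Finset.univ.filter fun b => AreConsecutive π a b).card ≤ 2 := by
    intro a
    have := ncard_areConsecutive_le π a
    rwa [Set.ncard_eq_toFinset_card', Set.toFinset_ofPred] at this
  have hsub : (linkGraph π M).neighborSet i ⊆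
      ((Finset.univ.filter fun b => AreConsecutive π i b).biUnion fun j =>
        Finset.univ.filter fun b => AreConsecutive π (f j) b : Finset (Fin n)) := by
    rintro l ⟨-, j, k, h1, h2, h3⟩
    rw [hf] at h2
    subst h2
    simp only [Finset.coe_biUnion, Set.mem_iUnion]
    exact ⟨j, by simpa using h1, by simpa using h3⟩
  refine (Set.ncard_le_ncard hsub (Set.toFinite _)).trans ?_
  rw [Set.ncard_coe_finset]
  refine (Finset.card_biUnion_le_card_mul _ _ 2 fun j _ => hcard _).trans ?_
  have := hcard i
  omega

variable {A : Matrix (Fin n) (Fin m) Bool} {π : Equiv.Perm (Fin n)} {M : SimpleGraph (Fin n)}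

theorem mem_stripRows {l : ℕ} {x : Fin n × Fin m} {r : Fin n} :
    r ∈ stripRows π l x ↔ (x.1 : ℕ) ≤ π.symm r ∧ (π.symm r : ℕ) < (x.1 : ℕ) + l := by
  simp [stripRows]

theorem IsStrip.apply_eq_true {l : ℕ} {x : Fin n × Fin m} (hx : IsStrip A π l x) {r : Fin n}
    (hr : r ∈ stripRows π l x) : A r x.2 = true := by
  rw [mem_stripRows] at hr
  obtain ⟨h, h1⟩ := hx.1 ((π.symm r : ℕ) - x.1) (by omega)
  have : (⟨(x.1 : ℕ) + ((π.symm r : ℕ) - x.1), h⟩ : Fin n) = π.symm r := by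
    ext
    simp only
    omega
  rwa [this, Equiv.apply_symm_apply] at h1

/-- Two strips of length two in the same column that share a row are equal, since strips are
maximal. -/
theorem IsStrip.eq_of_mem {x y : Fin n × Fin m} (hx : IsStrip A π 2 x) (hy : IsStrip A π 2 y)
    (h2 : x.2 = y.2) {r : Fin n} (hrx : r ∈ stripRows π 2 x) (hry : r ∈ stripRows π 2 y) :
    x = y := by
  rw [mem_stripRows] at hrx hry
  refine Prod.ext (Fin.ext ?_) h2
  rcases lt_trichotomy (x.1 : ℕ) y.1 with h | h | h
  · have h3 := hx.1 0 (by norm_num)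
    rw [add_zero, h2] at h3
    exact absurd h3 (hy.2.2 _ (by omega))
  · exact h
  · have h3 := hy.1 0 (by norm_num)
    rw [add_zero, ← h2] at h3
    exact absurd h3 (hx.2.2 _ (by omega))

theorem IsStrip.areConsecutive {x : Fin n × Fin m} (hx : IsStrip A π 2 x) {i j : Fin n}
    (hij : stripRows π 2 x = {i, j}) : AreConsecutive π i j := by
  obtain ⟨h, -⟩ := hx.1 1 (by norm_num)
  have hi : i ∈ stripRows π 2 x := by simp [hij]
  have hj : j ∈ stripRows π 2 x := by simp [hij]
  have hp : π x.1 ∈ stripRows π 2 x := by simp [mem_stripRows]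
  have hq : π ⟨(x.1 : ℕ) + 1, h⟩ ∈ stripRows π 2 x := by simp [mem_stripRows]
  have hne : i ≠ j := by
    rintro rfl
    rw [hij, Finset.pair_eq_singleton, Finset.mem_singleton] at hp hq
    have := congrArg Fin.val (π.injective (hp.trans hq.symm))
    simp at this
  have hne' : (π.symm i : ℕ) ≠ π.symm j := fun e => hne (π.symm.injective (Fin.ext e))
  rw [mem_stripRows] at hi hj
  unfold AreConsecutive
  omega

theorem residual_eq_true {r : Fin n} {c : Fin m} (h : A r c = true)
    (h' : ¬ InBandpassOf A M r c) : residual A M r c = true := by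
  simp [residual, h, h']

theorem IsB2.exists_link {s : Fin n × Fin m} (hs : IsB2 A π M s) :
    ∃ i l, i ∈ stripRows π 2 s ∧ (linkGraph π M).Adj i l ∧ residual A M i s.2 = true ∧
      residual A M l s.2 = true := by
  obtain ⟨hstrip, t, ht, hts, h2, i, j, k, l, hsr, htr, hM, hi, hl⟩ := hs
  have his : i ∈ stripRows π 2 s := by simp [hsr]
  have hlt : l ∈ stripRows π 2 t := by simp [htr]
  refine ⟨i, l, his, ⟨?_, j, k, hstrip.areConsecutive hsr, hM, ht.areConsecutive htr⟩,
    residual_eq_true (hstrip.apply_eq_true his) hi,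
    residual_eq_true (h2 ▸ ht.apply_eq_true hlt) hl⟩
  rintro rfl
  exact hts (ht.eq_of_mem hstrip h2 hlt his)

/-- Each pair of bandpasses in `B₂` leaves two `1`s in the residual matrix, in the two outer rows,
and these rows form an edge of `linkGraph π M`. -/
theorem card_B2_le (A : Matrix (Fin n) (Fin m) Bool) (π : Equiv.Perm (Fin n))
    (M : SimpleGraph (Fin n)) :
    (B2 A π M).card ≤ 2 * weight (edgeWeight (residual A M)) (linkGraph π M) := by
  classical
  rcases (B2 A π M).eq_empty_or_nonempty with h0 | ⟨s₀, -⟩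
  · simp [h0]
  have : Nonempty (Fin n × Fin n) := ⟨(s₀.1, s₀.1)⟩
  have hB : ∀ s ∈ B2 A π M, IsB2 A π M s := fun s hs => by simpa [B2] using hs
  have hch : ∀ s ∈ B2 A π M, ∃ p : Fin n × Fin n, p.1 ∈ stripRows π 2 s ∧
      (linkGraph π M).Adj p.1 p.2 ∧ residual A M p.1 s.2 = true ∧ residual A M p.2 s.2 = true := by
    intro s hs
    obtain ⟨i, l, h⟩ := (hB s hs).exists_link
    exact ⟨(i, l), h⟩
  choose! f h1 h2 h3 h4 using hch
  -- The bandpasses that the edges of `linkGraph π M` have in the residual matrix.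
  let T : Finset (Σ _ : Sym2 (Fin n), Fin m) :=
    (Finset.univ.filter fun e => e ∈ (linkGraph π M).edgeSet).sigma fun e =>
      Finset.univ.filter fun c : Fin m => ∀ r ∈ e, residual A M r c = true
  have hT : T.card = weight (edgeWeight (residual A M)) (linkGraph π M) := by
    simp only [T, Finset.card_sigma, weight, edgeWeight]
  rw [← hT]
  refine Finset.card_le_mul_card_image_of_maps_to
    (f := fun s => (⟨s((f s).1, (f s).2), s.2⟩ : Σ _ : Sym2 (Fin n), Fin m)) ?_ 2 ?_
  · intro s hs
    simp only [T, Finset.mem_sigma, Finset.mem_filter, Finset.mem_univ, true_and, Sym2.mem_iff,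
      SimpleGraph.mem_edgeSet]
    refine ⟨h2 s hs, ?_⟩
    rintro r (rfl | rfl)
    exacts [h3 s hs, h4 s hs]
  -- A strip is determined by its column and one of its rows, so the two ends of an edge account
  -- for at most two strips in a column.
  · rintro ⟨e, c⟩ -
    induction e with
    | _ a b =>
    refine (Finset.card_le_card_of_injOn (fun s => (f s).1) (t := {a, b}) ?_ ?_).trans
      Finset.card_le_two
    · intro s hs
      simp only [Finset.coe_filter, Set.mem_ofPred_eq, Sigma.mk.injEq, Sym2.eq_iff] at hs
      simp only [Finset.coe_insert, Finset.coe_singleton, Set.mem_insert_iff,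
        Set.mem_singleton_iff]
      tauto
    · intro s hs s' hs' hss
      simp only [Finset.coe_filter, Set.mem_ofPred_eq, Sigma.mk.injEq, heq_eq_eq] at hs hs'
      refine (hB s hs.1).1.eq_of_mem (hB s' hs'.1).1 (hs.2.2.trans hs'.2.2.symm) (h1 s hs.1) ?_
      have := h1 s' hs'.1
      simp only at hss
      rwa [← hss] at this

end PairedStrips

/-! ### Weights and the final partition -/

section Weights

variable {V : Type*} [Fintype V]

theorem weight_iSup_le {ι : Type*} [Fintype ι] (w : Sym2 V → ℕ) (Z : ι → SimpleGraph V) :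
    weight w (⨆ i, Z i) ≤ ∑ i, weight w (Z i) := by
  classical
  simp only [weight, Finset.sum_filter]
  rw [Finset.sum_comm]
  refine Finset.sum_le_sum fun e _ => ?_
  split_ifs with h
  · simp only [SimpleGraph.edgeSet_iSup, Set.mem_iUnion] at h
    obtain ⟨i, hi⟩ := h
    refine le_trans ?_ (Finset.single_le_sum (fun _ _ => Nat.zero_le _) (Finset.mem_univ i))
    simp [hi]
  · exact Nat.zero_le _

theorem weight_sup_le (w : Sym2 V → ℕ) (G H : SimpleGraph V) :
    weight w (G ⊔ H) ≤ weight w G + weight w H := by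
  classical
  simp only [weight, Finset.sum_filter]
  rw [← Finset.sum_add_distrib]
  refine Finset.sum_le_sum fun e _ => ?_
  simp only [SimpleGraph.edgeSet_sup, Set.mem_union]
  split_ifs <;> first | omega | tauto

theorem IsSevenAndHalfPartition.weight_le {w : Sym2 V → ℕ} {M C M₂ : SimpleGraph V}
    {X Y : Fin 4 → SimpleGraph V} (h : IsSevenAndHalfPartition w M C X Y)
    (h₂ : IsHeaviestOfSeven w X Y M₂) : (weight w C : ℝ) ≤ 7.5 * weight w M₂ := by
  have h1 : weight w C ≤ ∑ i, weight w (X i) + ∑ j, weight w (Y j) := by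
    rw [← h.union_eq]
    exact (weight_sup_le _ _ _).trans
      (Nat.add_le_add (weight_iSup_le _ _) (weight_iSup_le _ _))
  have hX0 : (weight w (X 0) : ℝ) ≤ weight w M₂ := by exact_mod_cast h₂.2 _ (by simp)
  have hX1 : (weight w (X 1) : ℝ) ≤ weight w M₂ := by exact_mod_cast h₂.2 _ (by simp)
  have hX2 : (weight w (X 2) : ℝ) ≤ weight w M₂ := by exact_mod_cast h₂.2 _ (by simp)
  have hY : ∀ j, (weight w (Y j) : ℝ) ≤ weight w M₂ := fun j => by
    exact_mod_cast h₂.2 _ (.inr ⟨j, rfl⟩)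
  have h2 : (weight w C : ℝ) ≤ ∑ i, (weight w (X i) : ℝ) + ∑ j, (weight w (Y j) : ℝ) := by
    exact_mod_cast h1
  rw [Fin.sum_univ_four, Fin.sum_univ_four] at h2
  linarith [hY 0, hY 1, hY 2, hY 3, h.weight_X3_le]

end Weights

section Matchings

variable {V : Type*} [Finite V] {M : SimpleGraph V}

theorem IsPerfectMatching.exists_partner (h : IsPerfectMatching M) :
    ∃ f : V → V, ∀ u x, M.Adj u x ↔ x = f u := by
  choose f hf using h.2
  refine ⟨f, fun u x => ⟨fun hx => ?_, fun hx => hx ▸ hf u⟩⟩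
  exact (Set.ncard_le_one (Set.toFinite _)).1 (h.1 u).2 x hx (f u) (hf u)

theorem isMatching_of_unique {G : SimpleGraph V} (h : ∀ a b b', G.Adj a b → G.Adj a b' → b = b') :
    IsMatching G := fun v =>
  ⟨Set.toFinite _, (Set.ncard_le_one (Set.toFinite _)).2 fun a ha b hb => h v a b ha hb⟩

theorem IsMatching.isBMatching_two_sup {G H : SimpleGraph V} (hG : IsMatching G)
    (hH : IsMatching H) : IsBMatching 2 (G ⊔ H) := fun v => by
  refine ⟨Set.toFinite _, ?_⟩
  have : (G ⊔ H).neighborSet v = G.neighborSet v ∪ H.neighborSet v := rfl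
  rw [this]
  have := Set.ncard_union_le (G.neighborSet v) (H.neighborSet v)
  have := (hG v).2
  have := (hH v).2
  omega

end Matchings

/-- Seven matchings that close no cycle with `M` form a partition as required, with `X 3` empty. -/
theorem IsAcyclicColoring.isSevenAndHalfPartition {V : Type*} [Fintype V] (w : Sym2 V → ℕ)
    {M C : SimpleGraph V} (hM : IsMatching M) {Z : Fin 7 → SimpleGraph V}
    (hZ : IsAcyclicColoring M C Z) :
    IsSevenAndHalfPartition w M C ![Z 0, Z 1, Z 2, ⊥] ![Z 3, Z 4, Z 5, Z 6] := by
  have hmatch : ∀ c, IsMatching (Z c) := fun c => isMatching_of_unique (hZ.matching c)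
  have hbot : IsMatching (⊥ : SimpleGraph V) := isMatching_of_unique (by simp)
  have hac : ∀ c, IsAcyclicTwoMatching (M ⊔ Z c) := fun c =>
    ⟨hM.isBMatching_two_sup (hmatch c), hZ.acyclic c⟩
  have hacbot : IsAcyclicTwoMatching (M ⊔ ⊥) :=
    ⟨hM.isBMatching_two_sup hbot, (hZ.acyclic 0).anti (sup_le_sup le_rfl bot_le)⟩
  have hdisj : ∀ c d, c ≠ d → Disjoint (Z c) (Z d) := fun c d hcd => by
    rw [SimpleGraph.disjoint_left]
    exact fun a b h1 h2 => hcd (hZ.color_unique _ _ _ _ h1 h2)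
  refine ⟨?_, ?_, ?_, ?_, ?_, ?_, ?_, ?_, ?_⟩
  · rintro (a | a) (b | b) hab <;> fin_cases a <;> fin_cases b <;>
      first
      | exact absurd rfl hab
      | exact disjoint_bot_left
      | exact disjoint_bot_right
      | exact hdisj _ _ (by decide)
  · ext a b
    simp [hZ.adj_iff, Fin.exists_fin_succ]
    tauto
  · intro i
    fin_cases i
    exacts [hmatch 0, hmatch 1, hmatch 2, hbot]
  · intro j
    fin_cases j
    exacts [hmatch 3, hmatch 4, hmatch 5, hmatch 6]
  · intro i
    fin_cases i
    exacts [hac 0, hac 1, hac 2, hacbot]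
  · intro j
    fin_cases j
    exacts [hac 3, hac 4, hac 5, hac 6]
  · simpa using hmatch 2
  · intro v p hp
    refine absurd hp ?_
    have : (M ⊔ Z 2 ⊔ ⊥).IsAcyclic := by simpa using hZ.acyclic 2
    exact this p
  · simp [weight]
    positivity

end Bandpass

theorem mainTheorem2 {n m : ℕ} (hn : Even n) (A : Matrix (Fin n) (Fin m) Bool)
    (πopt : Equiv.Perm (Fin n)) (hπ : Bandpass.IsOptimalPermutation A πopt)
    (M₁ : SimpleGraph (Fin n)) (hM₁ : Bandpass.IsPerfectMatching M₁)
    (hM₁max : Bandpass.IsMaxWeightBMatching (Bandpass.edgeWeight A) 1 M₁)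
    (w' : Sym2 (Fin n) → ℕ) (hw' : w' = Bandpass.edgeWeight (Bandpass.residual A M₁))
    (C C₁ C₂ : SimpleGraph (Fin n)) (hC : Bandpass.IsMaxWeightBMatching w' 4 C)
    (hC₁ : Bandpass.IsBMatching 2 C₁) (hC₂ : Bandpass.IsBMatching 2 C₂)
    (hdisj : Disjoint C₁ C₂) (hunion : C₁ ⊔ C₂ = C) :
    (∃ X Y : Fin 4 → SimpleGraph (Fin n),
      Bandpass.IsSevenAndHalfPartition w' M₁ (C₁ ⊔ C₂) X Y) ∧
    ∀ X Y : Fin 4 → SimpleGraph (Fin n),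
      Bandpass.IsSevenAndHalfPartition w' M₁ (C₁ ⊔ C₂) X Y →
      ∀ M₂ : SimpleGraph (Fin n), Bandpass.IsHeaviestOfSeven w' X Y M₂ →
        Bandpass.IsMatching M₂ ∧ Bandpass.IsAcyclicTwoMatching (M₁ ⊔ M₂) ∧
        (1 / 7.5 : ℝ) * (Bandpass.weight w' C : ℝ) ≤ (Bandpass.weight w' M₂ : ℝ) ∧
        (1 / 15 : ℝ) * ((Bandpass.B2 A πopt M₁).card : ℝ) ≤ (Bandpass.weight w' M₂ : ℝ) := by
  obtain ⟨f, hf⟩ := hM₁.exists_partner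
  subst hunion
  refine ⟨?_, fun X Y hXY M₂ hM₂ => ?_⟩
  · obtain ⟨Z, hZ⟩ := Bandpass.exists_isAcyclicColoring hf fun z => (hC.1 z).2
    exact ⟨_, _, hZ.isSevenAndHalfPartition w' hM₁.1⟩
  · have hweight := hXY.weight_le hM₂
    have hB : ((Bandpass.B2 A πopt M₁).card : ℝ) ≤ 2 * (Bandpass.weight w' (C₁ ⊔ C₂) : ℝ) := by
      have h1 := Bandpass.card_B2_le A πopt M₁
      rw [← hw'] at h1
      have h2 := hC.2 _ (Bandpass.isBMatching_linkGraph πopt hf)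
      exact_mod_cast h1.trans (Nat.mul_le_mul_left 2 h2)
    have hmem : Bandpass.IsMatching M₂ ∧ Bandpass.IsAcyclicTwoMatching (M₁ ⊔ M₂) := by
      rcases hM₂.1 with (rfl | rfl | rfl) | ⟨j, rfl⟩
      · exact ⟨hXY.matching_X 0, hXY.acyclic_X 0⟩
      · exact ⟨hXY.matching_X 1, hXY.acyclic_X 1⟩
      · exact ⟨hXY.matching_X 2, hXY.acyclic_X 2⟩
      · exact ⟨hXY.matching_Y j, hXY.acyclic_Y j⟩
    refine ⟨hmem.1, hmem.2, ?_, ?_⟩ <;> linarith
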